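/- Let $\mathbb H=\mathbb R^3$ be the first Heisenberg group, with the group law $$(x,y,z)\cdot(x',y',z')=\bigl(x+x',\,y+y',\,z+z'+\tfrac12(xy'-x'y)\bigr),$$ let $|(x,y,z)|_G=\bigl((x^2+y^2)^2+16z^2\bigr)^{1/4}$ be the Korányi gauge, and let $\tilde d_H(p,q)=|p\cdot q^{-1}|_G$ be the right invariant gauge metric. A set $A\subset\mathbb H$ is called h-convex if, for every $p\in A$ and every $q\in A$ of the form $q=p\cdot(a,b,0)$ with $a,b\in\mathbb R$, the segment $[p,q]$ of $\mathbb R^3$ is contained in $A$. The h-convex hull $\operatorname{co}(A)$ of a set $A\subset\mathbb H$ is the intersection of all h-convex sets in $\mathbb H$ that contain $A$. **Theorem (Quantitative inclusion principle).** Let $D,E\subset\mathbb H$ be two bounded sets, both open or both closed, with $D\subset E$. Then $\operatorname{co}(D)\subset\operatorname{co}(E)$, and $$\inf\{\tilde d_H(p,q): p\in\operatorname{co}(D),\ q\in\mathbb H\setminus\operatorname{co}(E)\}\ \ge\ \inf\{\tilde d_H(p,q): p\in D,\ q\in\mathbb H\setminus E\},$$ where the infimum of the empty set is $+\infty$. 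-/

import Mathlib

/-- The first Heisenberg group: `ℝ³` with coordinates `x, y, z`. -/
@[ext]
structure Heis where
  x : ℝ
  y : ℝ
  z : ℝ

namespace Heis

/-- The underlying point of `ℝ³`. -/
def toProd (p : Heis) : ℝ × ℝ × ℝ := (p.x, p.y, p.z)

/-- The usual topology of `ℝ³`. -/
instance : TopologicalSpace Heis := TopologicalSpace.induced toProd inferInstance

noncomputable instance : Mul Heis :=
  ⟨fun p q => ⟨p.x + q.x, p.y + q.y, p.z + q.z + (1 / 2) * (p.x * q.y - q.x * p.y)⟩⟩

instance : One Heis := ⟨⟨0, 0, 0⟩⟩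

instance : Inv Heis := ⟨fun p => ⟨-p.x, -p.y, -p.z⟩⟩

@[simp] theorem mul_x (p q : Heis) : (p * q).x = p.x + q.x := rfl
@[simp] theorem mul_y (p q : Heis) : (p * q).y = p.y + q.y := rfl
@[simp] theorem mul_z (p q : Heis) :
    (p * q).z = p.z + q.z + (1 / 2) * (p.x * q.y - q.x * p.y) := rfl
@[simp] theorem one_x : (1 : Heis).x = 0 := rfl
@[simp] theorem one_y : (1 : Heis).y = 0 := rfl
@[simp] theorem one_z : (1 : Heis).z = 0 := rfl
@[simp] theorem inv_x (p : Heis) : (p⁻¹).x = -p.x := rfl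
@[simp] theorem inv_y (p : Heis) : (p⁻¹).y = -p.y := rfl
@[simp] theorem inv_z (p : Heis) : (p⁻¹).z = -p.z := rfl

noncomputable instance : Group Heis :=
  Group.ofLeftAxioms
    (fun p q r => by ext <;> simp <;> ring)
    (fun p => by ext <;> simp)
    (fun p => by ext <;> simp)

/-- The Korányi gauge `|p|_G = ((x² + y²)² + 16 z²)^{1/4}`. -/
noncomputable def gauge (p : Heis) : ℝ :=
  ((p.x ^ 2 + p.y ^ 2) ^ 2 + 16 * p.z ^ 2) ^ (1 / 4 : ℝ)

/-- The right invariant gauge metric `|p · q⁻¹|_G`. -/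
noncomputable def rdist (p q : Heis) : ℝ := gauge (p * q⁻¹)

/-- `inf {rdist p q : p ∈ A, q ∈ B}`, with value `+∞` when `A` or `B` is empty. -/
noncomputable def rgap (A B : Set Heis) : ENNReal :=
  ⨅ p ∈ A, ⨅ q ∈ B, ENNReal.ofReal (rdist p q)

/-- A set is bounded if the gauge is bounded on it. -/
def Bounded (E : Set Heis) : Prop := ∃ R : ℝ, ∀ p ∈ E, gauge p ≤ R

/-- The horizontal plane through `p`: all `p · h` with `h = (a, b, 0)`. -/
def horizontalPlane (p : Heis) : Set Heis :=
  {q | ∃ a b : ℝ, q = p * ⟨a, b, 0⟩}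

/-- The segment `[p, q]` of `ℝ³`. -/
def seg (p q : Heis) : Set Heis := {w | w.toProd ∈ segment ℝ p.toProd q.toProd}

/-- (Weak) h-convexity. -/
def HConvex (E : Set Heis) : Prop :=
  ∀ p ∈ E, ∀ q ∈ horizontalPlane p ∩ E, seg p q ⊆ E

/-- The h-convex hull. -/
def co (E : Set Heis) : Set Heis := ⋂₀ {D | HConvex D ∧ E ⊆ D}

end Heis

namespace Heis

/-! In `rdist`, left translation by `g` moves every point by the same amount, `gauge g⁻¹`. If this
is below the gap, `g` maps `D` into `E`. Left translations are affine and preserve horizontal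
planes, hence h-convexity, so `g` also maps `co D` into `co E`. -/

theorem subset_co (A : Set Heis) : A ⊆ co A :=
  fun _ hp _ hC => hC.2 hp

theorem co_subset {A C : Set Heis} (hC : HConvex C) (h : A ⊆ C) : co A ⊆ C :=
  fun _ hp => hp C ⟨hC, h⟩

theorem hConvex_co (A : Set Heis) : HConvex (co A) := by
  intro p hp q hq w hw C hC
  exact hC.1 p (hp C hC) q ⟨hq.1, hq.2 C hC⟩ hw

theorem co_mono {A B : Set Heis} (h : A ⊆ B) : co A ⊆ co B :=
  co_subset (hConvex_co B) (h.trans (subset_co B))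

/-- Left translations map segments of `ℝ³` to segments. -/
theorem mul_mem_seg (g : Heis) {p q w : Heis} (hw : w ∈ seg p q) :
    g * w ∈ seg (g * p) (g * q) := by
  obtain ⟨a, b, ha, hb, hab, h⟩ := hw
  simp only [toProd, Prod.smul_mk, Prod.mk_add_mk, Prod.mk.injEq, smul_eq_mul] at h
  obtain ⟨hx, hy, hz⟩ := h
  refine ⟨a, b, ha, hb, hab, ?_⟩
  -- Left translation is affine, not linear: its constant terms match only because the weights sum
  -- to 1.
  obtain rfl : b = 1 - a := by linarith
  simp only [toProd, Prod.smul_mk, Prod.mk_add_mk, Prod.mk.injEq, smul_eq_mul, mul_x, mul_y,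
    mul_z, ← hx, ← hy, ← hz]
  refine ⟨?_, ?_, ?_⟩ <;> ring

theorem mul_mem_horizontalPlane (g : Heis) {p q : Heis} (hq : q ∈ horizontalPlane p) :
    g * q ∈ horizontalPlane (g * p) := by
  obtain ⟨a, b, rfl⟩ := hq
  exact ⟨a, b, (mul_assoc _ _ _).symm⟩

/-- Left translations preserve h-convexity. -/
theorem HConvex.preimage_mul_left {C : Set Heis} (hC : HConvex C) (g : Heis) :
    HConvex ((g * ·) ⁻¹' C) :=
  fun p hp q hq _ hw =>
    hC (g * p) hp (g * q) ⟨mul_mem_horizontalPlane g hq.1, hq.2⟩ (mul_mem_seg g hw)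

theorem rdist_mul_left_self (g p : Heis) : rdist p (g * p) = gauge g⁻¹ := by
  rw [rdist, mul_inv_rev, mul_inv_cancel_left]

theorem rgap_le_rdist {A B : Set Heis} {p q : Heis} (hp : p ∈ A) (hq : q ∈ B) :
    rgap A B ≤ ENNReal.ofReal (rdist p q) :=
  iInf₂_le_of_le p hp (iInf₂_le q hq)

/-- The right invariant gap to the complement does not decrease under h-convex hulls: a point
`g * p` at distance less than the gap from `p` is reached by a left translation that maps all
of `D` into `E`. -/
theorem rgap_le_rgap_co (D E : Set Heis) : rgap D Eᶜ ≤ rgap (co D) (co E)ᶜ := by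
  refine le_iInf₂ fun p hp => le_iInf₂ fun q hq => ?_
  by_contra! hlt
  obtain ⟨g, rfl⟩ : ∃ g, q = g * p := ⟨q * p⁻¹, (inv_mul_cancel_right q p).symm⟩
  -- The `g`-preimage of `co E` is h-convex, so it contains `co D` once it contains `D`.
  refine hq (co_subset ((hConvex_co E).preimage_mul_left g) (fun r hr => ?_) hp)
  refine subset_co E (by_contra fun hgr => ?_)
  have h := rgap_le_rdist hr (Set.mem_compl hgr)
  rw [rdist_mul_left_self] at h hlt
  exact hlt.not_ge h

end Heis

theorem theorem5p4 (D E : Set Heis)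
    (hD : Heis.Bounded D) (hE : Heis.Bounded E)
    (hDE : (IsOpen D ∧ IsOpen E) ∨ (IsClosed D ∧ IsClosed E))
    (hsub : D ⊆ E) :
    Heis.co D ⊆ Heis.co E ∧
      Heis.rgap D Eᶜ ≤ Heis.rgap (Heis.co D) (Heis.co E)ᶜ :=
  ⟨Heis.co_mono hsub, Heis.rgap_le_rgap_co D E⟩
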